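/- Let $\Gamma$ be a group, $\Gamma'=\{\Gamma_i\}_{i\in I}$ a finite non-empty family of subgroups (repetitions allowed), and $S\not\ni 1$ a finite symmetric generating set of $\Gamma$ such that $S\cap\Gamma_i$ generates $\Gamma_i$ for every $i\in I$. The combinatorial horoball on a graph $G$ has vertex set $G^{(0)}\times\mathbb N$; its edges join $(g,n)$ to $(g,n+1)$, and join $(g,n)$ to $(h,n)$ whenever $g\ne h$ and $d_G(g,h)\le 2^n$. The cusped graph $X$ of $(\Gamma,\Gamma')$ with respect to $S$ is obtained from the simplicial Cayley graph of $\Gamma$ (in which $g\neq h$ are adjacent iff $g^{-1}h\in S$) by gluing, for every $i\in I$ and every left coset $g\Gamma_i$, the combinatorial horoball on the full subgraph with vertex set $g\Gamma_i$ along its level $0$. For $n\in\mathbb N$, an $n$-horoball of $X$ is the full subgraph of $X$ spanned by the vertices of height (second coordinate) at least $n$ in one of the horoballs. Assume that the pair is relatively hyperbolic, i.e. that $X$ with its graph metric is Gromov hyperbolic, and let the integer $\delta\ge 0$ be a hyperbolicity constant of $X$, i.e. geodesic triangles of $X$ are $\delta$-slim. (It is enough to require that, for every geodesic triangle whose corners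 are vertices of $X$, every vertex on one side is at distance at most $\delta$ from a vertex on the union of the other two sides.) Let $C>\delta$ and $\kappa\ge 4\delta+6$ be integers, and let $\mathscr R=\mathscr R_\kappa(X)$ be the Rips complex: the simplicial complex whose simplices are the non-empty finite sets of vertices of $X$ of diameter at most $\kappa$ in $X$. Then (geometric realizations carrying the weak topology): 1. $\mathscr R$ is contractible; 2. every $C$-horoball of $\mathscr R$, i.e. the full subcomplex of $\mathscr R$ spanned by the vertices of a $C$-horoball of $X$, is contractible; 3. every ball of $\mathscr R$, i.e. for a vertex $v$ and $r\in\mathbb N$ the full subcomplex of $\mathscr R$ spanned by the vertices at distance at most $r$ from $v$ in the $1$-skeleton of $\mathscr R$, is contractible. -/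

import Mathlib

universe u v

/-! ### Simplicial complexes, their geometric realization, full subcomplexes, Rips complexes -/

/-- The set of points of the geometric realization of an abstract simplicial complex `K`, in
barycentric coordinates: finitely supported functions `x ≥ 0` on the vertices with total mass `1`
whose support is a simplex of `K`. -/
def SCRealization {V : Type u} (K : PreAbstractSimplicialComplex V) : Type u :=
  {x : V →₀ ℝ // x.support ∈ K.faces ∧ (∀ v, 0 ≤ x v) ∧ (x.sum fun _ t => t) = 1}

/-- The closed simplex of the realization spanned by the finite vertex set `s`. -/
def SCRealization.closedSimplex {V : Type u} (K : PreAbstractSimplicialComplex V) (s : Finset V) :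
    Set (SCRealization K) :=
  {x | x.1.support ⊆ s}

/-- The usual Euclidean topology of a closed simplex: convergence of the (finitely many)
barycentric coordinates. -/
@[reducible] def SCRealization.simplexTopology {V : Type u} (K : PreAbstractSimplicialComplex V)
    (s : Finset V) : TopologicalSpace (SCRealization.closedSimplex K s) :=
  TopologicalSpace.induced (fun x (v : V) => x.1.1 v) Pi.topologicalSpace

/-- The weak (CW) topology on the realization: a set is open iff its trace on every
closed simplex of `K` is open. -/
instance SCRealization.instTopologicalSpace {V : Type u} (K : PreAbstractSimplicialComplex V) :
    TopologicalSpace (SCRealization K) :=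
  ⨆ s : K.faces, TopologicalSpace.coinduced
    (Subtype.val : SCRealization.closedSimplex K s.1 → SCRealization K)
    (SCRealization.simplexTopology K s.1)

/-- The full subcomplex of `K` spanned by a set `A` of vertices. -/
def fullSubcomplex {V : Type u} (K : PreAbstractSimplicialComplex V) (A : Set V) :
    PreAbstractSimplicialComplex V where
  faces := {s | s ∈ K.faces ∧ (s : Set V) ⊆ A}
  isRelLowerSet_faces := fun _ hs =>
    ⟨(K.isRelLowerSet_faces hs.1).1, fun _ hts ht =>
      ⟨(K.isRelLowerSet_faces hs.1).2 hts ht, fun _ hv => hs.2 (hts hv)⟩⟩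

/-- The `1`-skeleton of a simplicial complex, as a simplicial graph. -/
def oneSkeleton {V : Type u} (K : PreAbstractSimplicialComplex V) : SimpleGraph V :=
  SimpleGraph.fromRel fun a b => ∃ s ∈ K.faces, a ∈ s ∧ b ∈ s

/-- The ball of radius `r` centred at the vertex `v` in a simplicial complex `K`: the full
subcomplex spanned by the vertices at distance at most `r` from `v` in the `1`-skeleton of `K`. -/
def complexBall {V : Type u} (K : PreAbstractSimplicialComplex V) (v : V) (r : ℕ) :
    PreAbstractSimplicialComplex V :=
  fullSubcomplex K {w | (oneSkeleton K).edist v w ≤ (r : ℕ∞)}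

/-- The Rips complex of a graph: the simplices are the nonempty finite sets of vertices
of diameter at most `κ` for the graph metric. -/
def ripsComplex {V : Type u} (G : SimpleGraph V) (κ : ℕ) : PreAbstractSimplicialComplex V where
  faces := {s | s.Nonempty ∧ ∀ a ∈ s, ∀ b ∈ s, G.edist a b ≤ (κ : ℕ∞)}
  isRelLowerSet_faces := fun _ hs =>
    ⟨hs.1, fun _ hts ht => ⟨ht, fun a ha b hb => hs.2 a (hts ha) b (hts hb)⟩⟩

/-! ### Hyperbolic graphs -/

/-- `δ`-hyperbolicity of a graph for an integer `δ`: geodesic triangles are `δ`-slim.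

Triangles have vertices of the graph as corners, and slimness is checked at the vertices on the
sides. If all geodesic triangles of the metric graph (edges of length `1`) are `δ`-slim with `δ`
an integer, then this condition holds: when a vertex `a` is within the integer distance `δ` of an
interior point of an edge, it is within `δ` of an endpoint of this edge. -/
def IsHyperbolicGraph {V : Type u} (G : SimpleGraph V) (δ : ℕ) : Prop :=
  ∀ (x y z : V) (p : G.Walk x y) (q : G.Walk y z) (r : G.Walk x z),
    p.length = G.dist x y → q.length = G.dist y z → r.length = G.dist x z →
    ∀ a ∈ p.support, ∃ b, (b ∈ q.support ∨ b ∈ r.support) ∧ G.edist a b ≤ (δ : ℕ∞)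

/-! ### Horoballs and the cusped graph of a group-pair -/

/-- The combinatorial horoball on a graph `G`. Vertices: `V × ℕ`. Edges: between `(g, n)` and
`(g, n + 1)`, and between `(g, n)` and `(h, n)` when `g ≠ h` and `d_G(g, h) ≤ 2 ^ n`.
(For `n = 0` the latter are exactly the edges of `G`.) -/
def combinatorialHoroball {V : Type u} (G : SimpleGraph V) : SimpleGraph (V × ℕ) :=
  SimpleGraph.fromRel fun a b =>
    (a.1 = b.1 ∧ b.2 = a.2 + 1) ∨ (a.2 = b.2 ∧ G.edist a.1 b.1 ≤ ((2 ^ a.2 : ℕ) : ℕ∞))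

/-- `S` is a finite symmetric generating set of `Γ` not containing `1`, which is compatible with
the family `P` of subgroups: `S ∩ P i` generates `P i` for every `i`. -/
structure IsCompatibleGeneratingSet {Γ : Type u} [Group Γ] {I : Type v} (P : I → Subgroup Γ)
    (S : Set Γ) : Prop where
  finite : S.Finite
  one_notMem : (1 : Γ) ∉ S
  inv_mem : ∀ s ∈ S, s⁻¹ ∈ S
  closure_eq_top : Subgroup.closure S = ⊤
  closure_inter : ∀ i, Subgroup.closure (S ∩ (P i : Set Γ)) = P i

/-- Vertices of the cusped graph: the elements of `Γ` (height `0`), and the triples `(g, i, n + 1)`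
of positive height `n + 1` in the horoball over the coset `g Γ_i`. -/
inductive CuspedVertex (Γ : Type u) (I : Type v) : Type (max u v)
  | base (g : Γ) : CuspedVertex Γ I
  | deep (g : Γ) (i : I) (n : ℕ) : CuspedVertex Γ I

/-- The vertex denoted by the triple `(g, i, n)`; all the triples `(g, i, 0)` with `i` varying
denote the same vertex. -/
def CuspedVertex.triple {Γ : Type u} {I : Type v} (g : Γ) (i : I) : ℕ → CuspedVertex Γ I
  | 0 => CuspedVertex.base g
  | n + 1 => CuspedVertex.deep g i n

/-- The left coset `g H`. -/
def leftCosetSet {Γ : Type u} [Group Γ] (H : Subgroup Γ) (g : Γ) : Set Γ :=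
  {h | g⁻¹ * h ∈ H}

/-- The cusped graph: the (simplicial) Cayley graph of `Γ` together with, for each `i` and each
left coset `g Γ_i`, the horoball on the full subgraph of the Cayley graph with vertex set `g Γ_i`,
glued along its level `0`. -/
def cuspedGraph {Γ : Type u} [Group Γ] {I : Type v} (P : I → Subgroup Γ) (S : Set Γ) :
    SimpleGraph (CuspedVertex Γ I) :=
  (SimpleGraph.mulCayley S).map CuspedVertex.base ⊔
    ⨆ (i : I) (g : Γ),
      (combinatorialHoroball ((SimpleGraph.mulCayley S).induce (leftCosetSet (P i) g))).map
        fun a => CuspedVertex.triple a.1.1 i a.2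

/-- The vertex set of the `n`-horoball over the coset `g Γ_i`: the vertices of height at least `n`
in the horoball over `g Γ_i`. -/
def horoballVertices {Γ : Type u} [Group Γ] {I : Type v} (P : I → Subgroup Γ) (i : I) (g : Γ)
    (n : ℕ) : Set (CuspedVertex Γ I) :=
  {x | ∃ h ∈ leftCosetSet (P i) g, ∃ m : ℕ, n ≤ m ∧ x = CuspedVertex.triple h i m}

/-!
The simplices of a Rips complex are determined by their edges, so contiguity of vertex maps can be
checked on pairs of vertices. Fix a base point `o`, and let `π` move each vertex `v` by
`max (2δ) 1` towards `o` along a geodesic, or to `o` if it is closer. If `d(v, w) ≤ κ` and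
`d(o, w) ≤ d(o, v)`, slimness of the triangle `o, v, w` gives `d(π v, w) ≤ κ`. Hence, if the
farther of two vertices is always moved first, the map which iterates `π` until the distance to
`o` is at most `n` preserves edges of the Rips complex, and it is contiguous to the one for `n + 1`.
These maps are constant for `n = 0` and stabilize at each vertex, so running through all of them in
the compact time interval `[0, ∞]` contracts the complex; continuity at `∞` holds because only
finitely many vertices are involved on each simplex.

The argument applies to any set of vertices that contains `o` and a geodesic from `o` to each of
its points. Balls have this property because the ball of radius `r` in the `1`-skeleton is the
ball of radius `κ r` in the graph. For a `C`-horoball, complete two of its points to a geodesic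
triangle whose third corner is very high above one of them: the two new sides stay at height at
least `C`, so the geodesic between the two points stays at height at least `C - δ > 0`, hence in
the horoball. Raising its vertices to height at least `C` then makes it no longer and keeps its
end points.
-/

open Set
open scoped ENNReal

namespace SCRealization

variable {V : Type*} {K : PreAbstractSimplicialComplex V}

/-! ### The weak topology -/

theorem continuous_coordinate (v : V) : Continuous fun x : SCRealization K => x.1 v :=
  continuous_iSup_dom.2 fun s => continuous_coinduced_dom.2 <|
    letI := simplexTopology K s.1
    (continuous_apply v).comp continuous_induced_dom

theorem simplexTopology_eq_subspaceTopology {s : Finset V} (hs : s ∈ K.faces) :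
    simplexTopology K s = instTopologicalSpaceSubtype := by
  apply le_antisymm
  · refine coinduced_le_iff_le_induced.1 ?_
    exact le_iSup (fun s : K.faces => TopologicalSpace.coinduced
      (Subtype.val : closedSimplex K s.1 → SCRealization K) (simplexTopology K s.1)) ⟨s, hs⟩
  · exact continuous_iff_le_induced.1 <|
      continuous_pi fun v => (continuous_coordinate v).comp continuous_subtype_val

theorem continuous_iff_forall_closedSimplex {Z : Type*} [TopologicalSpace Z]
    {F : SCRealization K → Z} :
    Continuous F ↔ ∀ s ∈ K.faces, Continuous fun x : closedSimplex K s => F x := by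
  refine continuous_iSup_dom.trans <| Subtype.forall.trans <| forall₂_congr fun s hs => ?_
  rw [continuous_coinduced_dom, simplexTopology_eq_subspaceTopology hs]
  rfl

theorem continuousOn_support_subset {Y : Type*} [TopologicalSpace Y] {F : Y → SCRealization K}
    (hF : ∀ v, Continuous fun y => (F y).1 v) {s : Finset V} (hs : s ∈ K.faces) :
    ContinuousOn F {y | (F y).1.support ⊆ s} := by
  let restrictedF : {y | (F y).1.support ⊆ s} → closedSimplex K s := fun y => ⟨F y, y.2⟩
  have hcont : Continuous restrictedF := by
    rw [← simplexTopology_eq_subspaceTopology hs]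
    exact continuous_induced_rng.2 <|
      continuous_pi fun v => (hF v).comp continuous_subtype_val
  exact continuousOn_iff_continuous_domRestrict.2 (continuous_subtype_val.comp hcont)

/-- The closed sets on which the support is contained in a given simplex on vertices of `T` form a
finite cover. -/
theorem continuous_of_support_subset {Y : Type*} [TopologicalSpace Y] {F : Y → SCRealization K}
    (hF : ∀ v, Continuous fun y => (F y).1 v) (T : Finset V) (hT : ∀ y, (F y).1.support ⊆ T) :
    Continuous F := by
  let simplices := {s : Finset V // s ∈ K.faces ∧ s ⊆ T}
  have : Finite simplices :=
    (T.powerset.finite_toSet.subset fun s hs => Finset.mem_powerset.2 hs.2 :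
      {s : Finset V | s ∈ K.faces ∧ s ⊆ T}.Finite).to_subtype
  refine (locallyFinite_of_finite fun s : simplices => {y | (F y).1.support ⊆ s.1}).continuous
    (iUnion_eq_univ_iff.2 fun y => ⟨⟨_, (F y).2.1, hT y⟩, Finset.Subset.refl _⟩) (fun s => ?_)
    fun s => continuousOn_support_subset hF s.2.1
  have : {y | (F y).1.support ⊆ s.1} = ⋂ v ∈ (s.1 : Set V)ᶜ, {y | (F y).1 v = 0} := by
    ext y
    simp only [mem_ofPred_eq, mem_iInter, mem_compl_iff, Finset.mem_coe, Finset.subset_iff,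
      Finsupp.mem_support_iff]
    exact forall_congr' fun v => not_imp_comm
  rw [this]
  exact isClosed_biInter fun v _ => isClosed_singleton.preimage (hF v)

theorem continuous_prod_of_closedSimplex {Y Z : Type*} [TopologicalSpace Y]
    [LocallyCompactSpace Y] [TopologicalSpace Z] {F : SCRealization K × Y → Z}
    (hF : ∀ s ∈ K.faces, Continuous fun p : closedSimplex K s × Y => F (p.1, p.2)) :
    Continuous F := by
  have hfiber (x : SCRealization K) : Continuous fun y => F (x, y) :=
    (hF _ x.2.1).comp (Continuous.prodMk_right (⟨x, Finset.Subset.refl _⟩ : closedSimplex K _))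
  let curried : SCRealization K → C(Y, Z) := fun x => ⟨fun y => F (x, y), hfiber x⟩
  have hcurried : Continuous curried :=
    continuous_iff_forall_closedSimplex.2 fun s hs => (ContinuousMap.curry ⟨_, hF s hs⟩).continuous
  exact ContinuousMap.continuous_uncurry_of_continuous ⟨curried, hcurried⟩

/-! ### Affine extensions -/

/-- The closed simplex with vertex set `t`, as a subset of the vector space `V →₀ ℝ` in which all
realizations of complexes on `V` live. -/
def simplexPoints (t : Finset V) : Set (V →₀ ℝ) :=
  {x | x.support ⊆ t ∧ (∀ v, 0 ≤ x v) ∧ (x.sum fun _ c => c) = 1}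

theorem convex_simplexPoints (t : Finset V) : Convex ℝ (simplexPoints t) := by
  rintro x ⟨hxt, hx, hx1⟩ y ⟨hyt, hy, hy1⟩ a b ha hb hab
  refine ⟨?_, fun v => add_nonneg (mul_nonneg ha (hx v)) (mul_nonneg hb (hy v)), ?_⟩
  · classical
    exact Finsupp.support_add.trans
      (Finset.union_subset (Finsupp.support_smul.trans hxt) (Finsupp.support_smul.trans hyt))
  · rw [Finsupp.sum_add_index' (fun _ => rfl) (fun _ _ _ => rfl),
      Finsupp.sum_smul_index fun _ => rfl, Finsupp.sum_smul_index fun _ => rfl,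
      ← Finsupp.mul_sum, ← Finsupp.mul_sum, hx1, hy1, mul_one, mul_one, hab]

theorem single_mem_simplexPoints {t : Finset V} {v : V} (hv : v ∈ t) :
    Finsupp.single v 1 ∈ simplexPoints t := by
  refine ⟨Finsupp.support_single_subset.trans (Finset.singleton_subset_iff.2 hv), fun w => ?_,
    Finsupp.sum_single_index rfl⟩
  exact (Finsupp.single_nonneg.2 zero_le_one : (0 : V →₀ ℝ) ≤ Finsupp.single v 1) w

/-- The point of the realization with barycentric coordinates `x`. -/
def ofSimplexPoints {t : Finset V} (ht : t ∈ K.faces) {x : V →₀ ℝ} (hx : x ∈ simplexPoints t) :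
    SCRealization K :=
  ⟨x, (K.isRelLowerSet_faces ht).2 hx.1 (Finsupp.support_nonempty_iff.2 <| by
    rintro rfl
    simpa using hx.2.2), hx.2⟩

theorem linearCombination_mem_simplexPoints (x : SCRealization K) {W : Type*} {φ : V → W →₀ ℝ}
    {t : Finset W} (hφ : ∀ v ∈ x.1.support, φ v ∈ simplexPoints t) :
    Finsupp.linearCombination ℝ φ x.1 ∈ simplexPoints t :=
  (convex_simplexPoints t).sum_mem (fun v _ => x.2.2.1 v) x.2.2.2 hφ

theorem linearCombination_apply_of_support_subset {W : Type*} {x : V →₀ ℝ} {s : Finset V}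
    (hs : x.support ⊆ s) (φ : V → W →₀ ℝ) (w : W) :
    Finsupp.linearCombination ℝ φ x w = ∑ v ∈ s, x v * φ v w := by
  rw [Finsupp.linearCombination_apply,
    Finsupp.sum_of_support_subset _ hs _ (by simp), Finsupp.finsetSum_apply]
  rfl

theorem continuous_linearCombination {W Y : Type*} {L : PreAbstractSimplicialComplex W}
    [TopologicalSpace Y] [LocallyCompactSpace Y] {φ : Y → V → W →₀ ℝ}
    (hφ : ∀ v w, Continuous fun y => φ y v w) {T : V → Finset W}
    (hT : ∀ y v, (φ y v).support ⊆ T v) {F : SCRealization K × Y → SCRealization L}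
    (hF : ∀ x y, (F (x, y)).1 = Finsupp.linearCombination ℝ (φ y) x.1) : Continuous F := by
  classical
  refine continuous_prod_of_closedSimplex fun s _ => ?_
  have hcoord (p : closedSimplex K s × Y) (w : W) :
      (F (p.1, p.2)).1 w = ∑ v ∈ s, p.1.1.1 v * φ p.2 v w := by
    rw [hF]
    exact linearCombination_apply_of_support_subset p.1.2 (φ p.2) w
  refine continuous_of_support_subset (fun w => ?_) (s.biUnion T) fun p w hw => ?_
  · simp only [hcoord]
    exact continuous_finsetSum _ fun v _ =>
      (((continuous_coordinate v).comp continuous_subtype_val).comp continuous_fst).mul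
        ((hφ v w).comp continuous_snd)
  · rw [Finsupp.mem_support_iff, hcoord] at hw
    obtain ⟨v, hv, hvw⟩ := Finset.exists_ne_zero_of_sum_ne_zero hw
    exact Finset.mem_biUnion.2
      ⟨v, hv, hT _ _ (Finsupp.mem_support_iff.2 (right_ne_zero_of_mul hvw))⟩

end SCRealization

/-! ### Contraction along contiguous vertex maps -/

/-- The piecewise linear function of time equal to `0` before time `n` and to `1` after time
`n + 1`. Time runs over `ℝ≥0∞`, which is compact and contains an instant `⊤` after all the others.
-/
noncomputable def rampWeight (n : ℕ) (s : ℝ≥0∞) : ℝ :=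
  (min 1 (s - n)).toReal

theorem continuous_rampWeight (n : ℕ) : Continuous (rampWeight n) :=
  ENNReal.continuousOn_toReal.comp_continuous
    (continuous_const.min (ENNReal.continuous_sub_right _))
    fun _ => ((min_le_left _ _).trans_lt ENNReal.one_lt_top).ne

theorem rampWeight_mem_Icc (n : ℕ) (s : ℝ≥0∞) : rampWeight n s ∈ Icc (0 : ℝ) 1 :=
  ⟨ENNReal.toReal_nonneg, ENNReal.toReal_mono ENNReal.one_ne_top (min_le_left _ _)⟩

theorem rampWeight_of_le {n : ℕ} {s : ℝ≥0∞} (h : s ≤ n) : rampWeight n s = 0 := by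
  rw [rampWeight, tsub_eq_zero_of_le h, min_eq_right zero_le_one, ENNReal.toReal_zero]

theorem rampWeight_of_add_one_le {n : ℕ} {s : ℝ≥0∞} (h : n + 1 ≤ s) : rampWeight n s = 1 := by
  rw [rampWeight,
    min_eq_left (ENNReal.le_sub_of_add_le_left (ENNReal.natCast_ne_top n) h), ENNReal.toReal_one]

section PolygonalPath

variable {E : Type*} [AddCommGroup E] [Module ℝ E] (f : ℕ → E) (N : ℕ)

/-- The path which passes through the points `f 0, …, f N` at the times `0, …, N`, is affine in
between, and rests at `f N` afterwards. -/
noncomputable def polygonalPath (s : ℝ≥0∞) : E :=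
  f 0 + ∑ n ∈ Finset.range N, rampWeight n s • (f (n + 1) - f n)

theorem polygonalPath_zero : polygonalPath f N 0 = f 0 := by
  simp only [polygonalPath, rampWeight_of_le zero_le, zero_smul, Finset.sum_const_zero, add_zero]

theorem polygonalPath_top : polygonalPath f N ⊤ = f N := by
  simp only [polygonalPath, rampWeight_of_add_one_le le_top, one_smul, Finset.sum_range_sub,
    add_sub_cancel]

theorem polygonalPath_mem {p : Submodule ℝ E} (hp : ∀ n ≤ N, f n ∈ p) (s : ℝ≥0∞) :
    polygonalPath f N s ∈ p :=
  p.add_mem (hp 0 (Nat.zero_le N)) <| p.sum_mem fun n hn =>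
    have hn : n < N := Finset.mem_range.1 hn
    p.smul_mem _ (p.sub_mem (hp _ hn) (hp _ hn.le))

variable {f N}

theorem polygonalPath_mem_segment (hf : ∀ n ≥ N, f n = f N) {n : ℕ} {s : ℝ≥0∞} (hn : n ≤ s)
    (hn' : s ≤ n + 1) : polygonalPath f N s ∈ segment ℝ (f n) (f (n + 1)) := by
  have hconst : ∀ m ≥ N, rampWeight m s • (f (m + 1) - f m) = 0 := fun m hm => by
    rw [hf m hm, hf (m + 1) (hm.trans m.le_succ), sub_self, smul_zero]
  have hfuture : ∀ m ≥ n + 1, rampWeight m s • (f (m + 1) - f m) = 0 := fun m hm => by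
    rw [rampWeight_of_le (hn'.trans (by exact_mod_cast hm)), zero_smul]
  have hpast : ∑ m ∈ Finset.range n, rampWeight m s • (f (m + 1) - f m) = f n - f 0 := by
    rw [← Finset.sum_range_sub]
    refine Finset.sum_congr rfl fun m hm => ?_
    have hm : ((m + 1 : ℕ) : ℝ≥0∞) ≤ n := Nat.cast_le.2 (Finset.mem_range.1 hm)
    rw [rampWeight_of_add_one_le (by exact_mod_cast hm.trans hn), one_smul]
  have hpath : polygonalPath f N s = f n + rampWeight n s • (f (n + 1) - f n) := by
    rw [polygonalPath, ← Finset.eventually_constant_sum hconst (le_max_left N (n + 1)),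
      Finset.eventually_constant_sum hfuture (le_max_right N (n + 1)), Finset.sum_range_succ, hpast]
    abel
  rw [hpath, segment_eq_image']
  exact ⟨_, rampWeight_mem_Icc n s, rfl⟩

end PolygonalPath

theorem contractibleSpace_of_ennreal_homotopy {X : Type*} [TopologicalSpace X]
    {H : X × ℝ≥0∞ → X} (hH : Continuous H) {x₀ : X} (hzero : ∀ x, H (x, 0) = x₀)
    (htop : ∀ x, H (x, ⊤) = x) : ContractibleSpace X := by
  have htime : Continuous fun t : unitInterval => (ENNReal.ofReal t)⁻¹ - 1 :=
    (ENNReal.continuous_sub_right 1).comp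
      (ENNReal.continuous_ofReal.comp continuous_subtype_val).inv
  refine (contractible_iff_id_nullhomotopic X).2
    ⟨x₀, ⟨⟨⟨fun p => H (p.2, (ENNReal.ofReal p.1)⁻¹ - 1), ?_⟩, fun x => ?_, fun x => ?_⟩⟩⟩
  · exact hH.comp (continuous_snd.prodMk (htime.comp continuous_fst))
  · simp [htop]
  · simp [hzero]

/-- Two maps between the vertex sets of simplicial complexes are contiguous if they send every
simplex into a common simplex. -/
def Contiguous {V W : Type*} (K : PreAbstractSimplicialComplex V)
    (L : PreAbstractSimplicialComplex W) (φ ψ : V → W) : Prop :=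
  ∀ s ∈ K.faces, ∃ t ∈ L.faces, ∀ v ∈ s, φ v ∈ t ∧ ψ v ∈ t

namespace SCRealization

variable {V : Type*} {K : PreAbstractSimplicialComplex V} {r : ℕ → V → V} {N : V → ℕ}

theorem exists_linearCombination_polygonalPath_mem (hN : ∀ v, ∀ n ≥ N v, r n v = v)
    (hr : ∀ n, Contiguous K K (r n) (r (n + 1))) (x : SCRealization K) (s : ℝ≥0∞) :
    ∃ t ∈ K.faces, Finsupp.linearCombination ℝ
      (fun v => polygonalPath (fun n => Finsupp.single (r n v) 1) (N v) s) x.1 ∈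
        simplexPoints t := by
  rcases eq_or_ne s ⊤ with rfl | hs
  · refine ⟨_, x.2.1, linearCombination_mem_simplexPoints x fun v hv => ?_⟩
    rw [polygonalPath_top, hN v _ le_rfl]
    exact single_mem_simplexPoints hv
  · lift s to NNReal using hs
    obtain ⟨t, ht, hrt⟩ := hr ⌊s⌋₊ _ x.2.1
    refine ⟨t, ht, linearCombination_mem_simplexPoints x fun v hv => ?_⟩
    have hsegment := polygonalPath_mem_segment (f := fun n => Finsupp.single (r n v) (1 : ℝ))
      (N := N v) (fun n hn => by rw [hN v n hn, hN v _ le_rfl]) (n := ⌊s⌋₊) (s := s)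
      (by exact_mod_cast Nat.floor_le s.2) (by exact_mod_cast (Nat.lt_floor_add_one s).le)
    exact (convex_simplexPoints t).segment_subset (single_mem_simplexPoints (hrt v hv).1)
      (single_mem_simplexPoints (hrt v hv).2) hsegment

theorem contractibleSpace_of_contiguous {v₀ : V} (hv₀ : {v₀} ∈ K.faces) (hr₀ : ∀ v, r 0 v = v₀)
    (hN : ∀ v, ∀ n ≥ N v, r n v = v) (hr : ∀ n, Contiguous K K (r n) (r (n + 1))) :
    ContractibleSpace (SCRealization K) := by
  classical
  let φ (s : ℝ≥0∞) (v : V) : V →₀ ℝ :=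
    polygonalPath (fun n => Finsupp.single (r n v) 1) (N v) s
  choose t ht hmem using exists_linearCombination_polygonalPath_mem hN hr
  let H (p : SCRealization K × ℝ≥0∞) : SCRealization K :=
    ofSimplexPoints (ht p.1 p.2) (hmem p.1 p.2)
  have hφ (v w : V) : Continuous fun s => φ s v w := by
    simp only [φ, polygonalPath, Finsupp.add_apply, Finsupp.finsetSum_apply, Finsupp.smul_apply,
      smul_eq_mul]
    exact continuous_const.add <|
      continuous_finsetSum _ fun n _ => (continuous_rampWeight n).mul continuous_const
  have hsupport (s : ℝ≥0∞) (v : V) :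
      (φ s v).support ⊆ (Finset.range (N v + 1)).image fun n => r n v := by
    rw [← Finset.coe_subset, ← Finsupp.mem_supported ℝ]
    refine polygonalPath_mem _ _ (fun n hn => Finsupp.single_mem_supported ℝ _ ?_) s
    exact Finset.mem_image_of_mem _ (Finset.mem_range_succ_iff.2 hn)
  have hH : Continuous H := continuous_linearCombination hφ hsupport fun _ _ => rfl
  refine contractibleSpace_of_ennreal_homotopy hH
    (x₀ := ofSimplexPoints hv₀ (single_mem_simplexPoints (Finset.mem_singleton_self v₀)))
    (fun x => Subtype.ext ?_) (fun x => Subtype.ext ?_)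
  · change Finsupp.linearCombination ℝ (φ 0) x.1 = Finsupp.single v₀ 1
    simp only [φ, polygonalPath_zero, hr₀, Finsupp.linearCombination_apply, Finsupp.sum]
    rw [← Finset.sum_smul]
    exact (congrArg (· • _) x.2.2.2).trans (one_smul ℝ _)
  · change Finsupp.linearCombination ℝ (φ ⊤) x.1 = x.1
    simp only [φ, polygonalPath_top, hN _ _ le_rfl, Finsupp.linearCombination_apply,
      Finsupp.smul_single, smul_eq_mul, mul_one, Finsupp.sum_single]

end SCRealization

/-! ### Clique complexes -/

/-- `K` is the clique complex of the relation `R`: its simplices are the nonempty finite sets all of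
whose elements, repetitions included, are pairwise related. -/
def IsCliqueComplex {V : Type*} (K : PreAbstractSimplicialComplex V) (R : V → V → Prop) : Prop :=
  ∀ s, s ∈ K.faces ↔ s.Nonempty ∧ ∀ a ∈ s, ∀ b ∈ s, R a b

theorem IsCliqueComplex.contiguous {V W : Type*} {K : PreAbstractSimplicialComplex V}
    {L : PreAbstractSimplicialComplex W} {R : V → V → Prop} {Q : W → W → Prop}
    (hK : IsCliqueComplex K R) (hL : IsCliqueComplex L Q) (hR : ∀ a b, R a b → R b a)
    (hQ : ∀ a b, Q a b → Q b a) {φ ψ : V → W} (hφ : ∀ a b, R a b → Q (φ a) (φ b))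
    (hφψ : ∀ a b, R a b → Q (φ a) (ψ b)) (hψ : ∀ a b, R a b → Q (ψ a) (ψ b)) :
    Contiguous K L φ ψ := by
  classical
  intro s hs
  obtain ⟨hne, hclique⟩ := (hK s).1 hs
  refine ⟨s.image φ ∪ s.image ψ, (hL _).2 ⟨(hne.image φ).mono Finset.subset_union_left, ?_⟩,
    fun v hv => ⟨Finset.mem_union_left _ (Finset.mem_image_of_mem φ hv),
      Finset.mem_union_right _ (Finset.mem_image_of_mem ψ hv)⟩⟩
  simp only [Finset.mem_union, Finset.mem_image]
  rintro _ (⟨a, ha, rfl⟩ | ⟨a, ha, rfl⟩) _ (⟨b, hb, rfl⟩ | ⟨b, hb, rfl⟩)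
  · exact hφ a b (hclique a ha b hb)
  · exact hφψ a b (hclique a ha b hb)
  · exact hQ _ _ (hφψ b a (hR a b (hclique a ha b hb)))
  · exact hψ a b (hclique a ha b hb)

section Shrink

variable {V : Type*} {ρ : V → ℕ} {π : V → V} {R : V → V → Prop}

/-- Iterate the rank-decreasing map `π` until the rank `ρ` is at most `n`. -/
noncomputable def shrink (hπ : ∀ v, ρ v ≠ 0 → ρ (π v) < ρ v) (n : ℕ) (v : V) : V :=
  if ρ v ≤ n then v else shrink hπ n (π v)
termination_by ρ v
decreasing_by exact hπ v (by lia)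

variable (hπ : ∀ v, ρ v ≠ 0 → ρ (π v) < ρ v)

theorem shrink_of_le {n : ℕ} {v : V} (h : ρ v ≤ n) : shrink hπ n v = v := by
  rw [shrink, if_pos h]

theorem shrink_of_lt {n : ℕ} {v : V} (h : n < ρ v) : shrink hπ n v = shrink hπ n (π v) := by
  rw [shrink, if_neg h.not_ge]

theorem rank_shrink_le (n : ℕ) (v : V) : ρ (shrink hπ n v) ≤ n := by
  induction v using WellFounded.induction (measure ρ).wf with
  | _ v ih =>
    rcases le_or_gt (ρ v) n with h | h
    · rwa [shrink_of_le hπ h]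
    · rw [shrink_of_lt hπ h]
      exact ih _ (hπ v (by lia))

theorem shrink_rel (hsymm : ∀ a b, R a b → R b a)
    (hR : ∀ a b, R a b → ρ b ≤ ρ a → R (π a) b) {n m : ℕ} (hnm : n ≤ m) (hmn : m ≤ n + 1)
    {a b : V} (hab : R a b) : R (shrink hπ n a) (shrink hπ m b) := by
  induction hk : ρ a + ρ b using Nat.strong_induction_on generalizing a b with
  | _ k ih =>
    subst hk
    have shrink_left (ha : n < ρ a) (hle : ρ b ≤ ρ a) : R (shrink hπ n a) (shrink hπ m b) := by
      rw [shrink_of_lt hπ ha]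
      exact ih _ (by have := hπ a (by lia); lia) (hR a b hab hle) rfl
    have shrink_right (hb : m < ρ b) (hle : ρ a ≤ ρ b) : R (shrink hπ n a) (shrink hπ m b) := by
      rw [shrink_of_lt hπ hb]
      exact ih _ (by have := hπ b (by lia); lia)
        (hsymm _ _ (hR b a (hsymm a b hab) hle)) rfl
    rcases le_or_gt (ρ a) n with ha | ha <;> rcases le_or_gt (ρ b) m with hb | hb
    · rwa [shrink_of_le hπ ha, shrink_of_le hπ hb]
    · exact shrink_right hb (by lia)
    · exact shrink_left ha (by lia)
    · exact (le_total (ρ b) (ρ a)).elim (shrink_left ha) (shrink_right hb)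

end Shrink

theorem IsCliqueComplex.contractibleSpace_of_rank {V : Type*} {K : PreAbstractSimplicialComplex V}
    {R : V → V → Prop} {ρ : V → ℕ} {π : V → V} (hK : IsCliqueComplex K R)
    (hπ : ∀ v, ρ v ≠ 0 → ρ (π v) < ρ v) (hsymm : ∀ a b, R a b → R b a)
    (hR : ∀ a b, R a b → ρ b ≤ ρ a → R (π a) b) {o : V} (ho : R o o) (hρ : ∀ v, ρ v = 0 → v = o) :
    ContractibleSpace (SCRealization K) := by
  refine SCRealization.contractibleSpace_of_contiguous (r := shrink hπ) (N := ρ) (v₀ := o)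
    ((hK _).2 ?_) (fun v => hρ _ (Nat.le_zero.1 (rank_shrink_le hπ 0 v)))
    (fun _ _ => shrink_of_le hπ) fun n => hK.contiguous hK hsymm hsymm ?_ ?_ ?_
  · simpa using ho
  all_goals exact fun a b => shrink_rel hπ hsymm hR (by lia) (by lia)


/-! ### Rips complexes of hyperbolic graphs -/

section Rips

variable {V : Type*} {G : SimpleGraph V} {δ κ m : ℕ}

theorem edist_le_natCast_iff (hG : G.Connected) {a b : V} {n : ℕ} :
    G.edist a b ≤ n ↔ G.dist a b ≤ n := by
  rw [← (hG a b).coe_dist_eq_edist, Nat.cast_le]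

theorem exists_walk_length_le_of_edist_le {a b : V} {n : ℕ} (h : G.edist a b ≤ n) :
    ∃ p : G.Walk a b, p.length ≤ n := by
  obtain ⟨p, hp⟩ := SimpleGraph.exists_walk_of_edist_ne_top
    (ne_top_of_le_ne_top (ENat.natCast_ne_top n) h)
  exact ⟨p, Nat.cast_le.1 (hp.trans_le h)⟩

theorem dist_getVert_of_length_eq_dist {a b : V} {p : G.Walk a b}
    (hp : p.length = G.dist a b) {n : ℕ} (hn : n ≤ G.dist a b) :
    G.dist a (p.getVert n) = n ∧ G.dist (p.getVert n) b = G.dist a b - n := by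
  rw [← SimpleGraph.length_eq_dist_of_subwalk hp (p.isSubwalk_take n),
    ← SimpleGraph.length_eq_dist_of_subwalk hp (p.isSubwalk_drop n),
    SimpleGraph.Walk.take_length, SimpleGraph.Walk.drop_length]
  lia

theorem dist_add_dist_of_mem_support {a b c : V} {p : G.Walk a b}
    (hp : p.length = G.dist a b) (hc : c ∈ p.support) :
    G.dist a c + G.dist c b = G.dist a b := by
  obtain ⟨n, rfl, hn⟩ := SimpleGraph.Walk.mem_support_iff_exists_getVert.1 hc
  obtain ⟨hleft, hright⟩ := dist_getVert_of_length_eq_dist hp (hp ▸ hn)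
  lia

theorem IsHyperbolicGraph.dist_le_of_mem_geodesic (hδ : IsHyperbolicGraph G δ) (hG : G.Connected)
    (hm : 2 * δ ≤ m) (hκ : m + 2 * δ ≤ κ) {o v w c : V} {p : G.Walk o v}
    (hp : p.length = G.dist o v) (hc : c ∈ p.support) (hcv : G.dist c v = m)
    (hvw : G.dist v w ≤ κ) (how : G.dist o w ≤ G.dist o v) : G.dist c w ≤ κ := by
  obtain ⟨q, hq⟩ := hG.exists_walk_length_eq_dist v w
  obtain ⟨r, hr⟩ := hG.exists_walk_length_eq_dist o w
  obtain ⟨b, hb, hcb⟩ := hδ o v w p q r hp hq hr c hc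
  rw [edist_le_natCast_iff hG] at hcb
  have hocv := dist_add_dist_of_mem_support hp hc
  have hcbw := hG.dist_triangle (u := c) (v := b) (w := w)
  rcases hb with hb | hb
  · have hvbw := dist_add_dist_of_mem_support hq hb
    have hcbv := hG.dist_triangle (u := c) (v := b) (w := v)
    rw [G.dist_comm (u := b) (v := v)] at hcbv
    lia
  · have hobw := dist_add_dist_of_mem_support hr hb
    have hobc := hG.dist_triangle (u := o) (v := b) (w := c)
    rw [G.dist_comm (u := b) (v := c)] at hobc
    lia

/-- The set `A` contains, with each of its points, some geodesic of `G` from `o` to that point. -/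
def IsGeodesicallyStarShaped (G : SimpleGraph V) (A : Set V) (o : V) : Prop :=
  ∀ v ∈ A, ∃ p : G.Walk o v, p.length = G.dist o v ∧ ∀ a ∈ p.support, a ∈ A

/-- The vertex `c` lies at distance `m` from `v` on a geodesic from `o`, or is `o` itself if `v` is
too close to `o`. -/
theorem IsGeodesicallyStarShaped.exists_closer {A : Set V} {o : V}
    (hA : IsGeodesicallyStarShaped G A o) (hδ : IsHyperbolicGraph G δ) (hG : G.Connected)
    (hm₀ : m ≠ 0) (hm : 2 * δ ≤ m) (hκ : m + 2 * δ ≤ κ) (v : V) :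
    ∃ c, (G.dist o v ≠ 0 → G.dist o c < G.dist o v) ∧ (v ∈ A → c ∈ A ∧
      ∀ w, G.dist v w ≤ κ → G.dist o w ≤ G.dist o v → G.dist c w ≤ κ) := by
  by_cases hvA : v ∈ A
  · obtain ⟨p, hp, hpA⟩ := hA v hvA
    rcases le_or_gt m (G.dist o v) with hfar | hnear
    · have hc := p.getVert_mem_support (G.dist o v - m)
      obtain ⟨hoc, hcv⟩ := dist_getVert_of_length_eq_dist hp (Nat.sub_le _ m)
      exact ⟨_, by lia, fun _ => ⟨hpA _ hc, fun w =>
        hδ.dist_le_of_mem_geodesic hG hm hκ hp hc (by lia)⟩⟩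
    · refine ⟨o, fun hv => ?_, fun _ => ⟨hpA o p.start_mem_support, by lia⟩⟩
      rw [SimpleGraph.dist_self]
      lia
  · refine ⟨o, fun hv => ?_, fun h => absurd h hvA⟩
    rw [SimpleGraph.dist_self]
    lia

theorem isCliqueComplex_fullSubcomplex_ripsComplex (hG : G.Connected) (κ : ℕ) (A : Set V) :
    IsCliqueComplex (fullSubcomplex (ripsComplex G κ) A)
      fun a b => a ∈ A ∧ b ∈ A ∧ G.dist a b ≤ κ := by
  intro s
  constructor
  · rintro ⟨⟨hne, hdiam⟩, hsA⟩
    exact ⟨hne, fun a ha b hb => ⟨hsA ha, hsA hb, (edist_le_natCast_iff hG).1 (hdiam a ha b hb)⟩⟩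
  · rintro ⟨hne, h⟩
    exact ⟨⟨hne, fun a ha b hb => (edist_le_natCast_iff hG).2 (h a ha b hb).2.2⟩,
      fun a ha => (h a ha a ha).1⟩

theorem IsGeodesicallyStarShaped.contractibleSpace_ripsComplex {A : Set V} {o : V}
    (hA : IsGeodesicallyStarShaped G A o) (hδ : IsHyperbolicGraph G δ) (hG : G.Connected)
    (hκ : 4 * δ ≤ κ) (hκ₀ : κ ≠ 0) (ho : o ∈ A) :
    ContractibleSpace (SCRealization (fullSubcomplex (ripsComplex G κ) A)) := by
  choose π hπ hπA using hA.exists_closer (m := max (2 * δ) 1) (κ := κ) hδ hG (by lia) (by lia)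
    (by lia)
  refine (isCliqueComplex_fullSubcomplex_ripsComplex hG κ A).contractibleSpace_of_rank hπ ?_ ?_
    (o := o) ⟨ho, ho, by simp⟩ fun v hv => (hG.dist_eq_zero_iff.1 hv).symm
  · rintro a b ⟨ha, hb, hab⟩
    exact ⟨hb, ha, G.dist_comm ▸ hab⟩
  · rintro a b ⟨ha, hb, hab⟩ hle
    exact ⟨(hπA a ha).1, hb, (hπA a ha).2 b hab hle⟩

theorem fullSubcomplex_univ (K : PreAbstractSimplicialComplex V) :
    fullSubcomplex K Set.univ = K := by
  ext s
  simp [fullSubcomplex]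

theorem contractibleSpace_ripsComplex (hδ : IsHyperbolicGraph G δ) (hG : G.Connected)
    (hκ : 4 * δ ≤ κ) (hκ₀ : κ ≠ 0) : ContractibleSpace (SCRealization (ripsComplex G κ)) := by
  obtain ⟨o⟩ := hG.nonempty
  have hstar : IsGeodesicallyStarShaped G Set.univ o := fun v _ =>
    (hG.exists_walk_length_eq_dist o v).imp fun _ hp => ⟨hp, fun a _ => Set.mem_univ a⟩
  rw [← fullSubcomplex_univ (ripsComplex G κ)]
  exact hstar.contractibleSpace_ripsComplex hδ hG hκ hκ₀ (Set.mem_univ o)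

theorem dist_le_mul_length_of_oneSkeleton_walk (hG : G.Connected) {a b : V}
    (p : (oneSkeleton (ripsComplex G κ)).Walk a b) : G.dist a b ≤ κ * p.length := by
  induction p with
  | nil => simp
  | @cons a c b h p ih =>
    have hac : G.dist a c ≤ κ := by
      rw [← edist_le_natCast_iff hG]
      obtain ⟨-, ⟨s, hs, ha, hc⟩ | ⟨s, hs, hc, ha⟩⟩ := h <;> exact hs.2 a ha c hc
    have := hG.dist_triangle (u := a) (v := c) (w := b)
    rw [SimpleGraph.Walk.length_cons, Nat.mul_succ]
    lia

theorem edist_oneSkeleton_le_one {a b : V} (h : G.edist a b ≤ κ) :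
    (oneSkeleton (ripsComplex G κ)).edist a b ≤ 1 := by
  classical
  rw [SimpleGraph.edist_le_one_iff_adj_or_eq, or_iff_not_imp_right]
  refine fun hab => ⟨hab, Or.inl ⟨{a, b}, ⟨by simp, ?_⟩, by simp, by simp⟩⟩
  simpa using ⟨h, G.edist_comm ▸ h⟩

theorem edist_oneSkeleton_le_natCast_iff (hG : G.Connected) {a b : V} {n : ℕ} :
    (oneSkeleton (ripsComplex G κ)).edist a b ≤ n ↔ G.dist a b ≤ κ * n := by
  constructor
  · intro h
    obtain ⟨p, hp⟩ := exists_walk_length_le_of_edist_le h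
    exact (dist_le_mul_length_of_oneSkeleton_walk hG p).trans (Nat.mul_le_mul_left _ hp)
  · induction n generalizing b with
    | zero =>
      intro h
      rw [hG.dist_eq_zero_iff.1 (Nat.le_zero.1 h), SimpleGraph.edist_self]
      exact zero_le
    | succ n ih =>
      intro h
      rw [Nat.mul_succ] at h
      obtain ⟨p, hp⟩ := hG.exists_walk_length_eq_dist a b
      obtain ⟨hac, hcb⟩ := dist_getVert_of_length_eq_dist hp (Nat.sub_le _ κ)
      rw [Nat.cast_succ]
      exact SimpleGraph.edist_triangle.trans <|
        add_le_add (ih (hac.trans_le (by lia)))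
          (edist_oneSkeleton_le_one ((edist_le_natCast_iff hG).2 (by lia)))

theorem contractibleSpace_complexBall_ripsComplex (hδ : IsHyperbolicGraph G δ) (hG : G.Connected)
    (hκ : 4 * δ ≤ κ) (hκ₀ : κ ≠ 0) (o : V) (n : ℕ) :
    ContractibleSpace (SCRealization (complexBall (ripsComplex G κ) o n)) := by
  refine IsGeodesicallyStarShaped.contractibleSpace_ripsComplex (o := o) (fun v hv => ?_)
    hδ hG hκ hκ₀ (by simp)
  obtain ⟨p, hp⟩ := hG.exists_walk_length_eq_dist o v
  refine ⟨p, hp, fun a ha => (edist_oneSkeleton_le_natCast_iff hG).2 ?_⟩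
  have := dist_add_dist_of_mem_support hp ha
  exact (Nat.le.intro this).trans ((edist_oneSkeleton_le_natCast_iff hG).1 hv)

end Rips

/-! ### Combinatorial horoballs -/

section Horoball

variable {V : Type*} {G : SimpleGraph V}

theorem combinatorialHoroball_adj_iff {a b : V × ℕ} :
    (combinatorialHoroball G).Adj a b ↔ a.1 = b.1 ∧ (b.2 = a.2 + 1 ∨ a.2 = b.2 + 1) ∨
      a.1 ≠ b.1 ∧ a.2 = b.2 ∧ G.edist a.1 b.1 ≤ (2 ^ a.2 : ℕ) := by
  obtain ⟨v, n⟩ := a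
  obtain ⟨w, m⟩ := b
  rw [combinatorialHoroball, SimpleGraph.fromRel_adj, G.edist_comm (u := w)]
  grind

theorem combinatorialHoroball_adj_max (C : ℕ) {a b : V × ℕ}
    (h : (combinatorialHoroball G).Adj a b) :
    (a.1, max a.2 C) = (b.1, max b.2 C) ∨
      (combinatorialHoroball G).Adj (a.1, max a.2 C) (b.1, max b.2 C) := by
  rw [combinatorialHoroball_adj_iff] at h ⊢
  rcases h with ⟨hv, hn⟩ | ⟨hv, hn, hd⟩
  · grind
  · refine Or.inr (Or.inr ⟨hv, by rw [hn], hd.trans (Nat.cast_le.2 ?_)⟩)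
    exact Nat.pow_le_pow_right two_pos (le_max_left _ _)

theorem edist_combinatorialHoroball_vertical_le (v : V) {n m : ℕ} (hnm : n ≤ m) :
    (combinatorialHoroball G).edist (v, n) (v, m) ≤ (m - n : ℕ) := by
  induction m, hnm using Nat.le_induction with
  | base => simp
  | succ m hnm ih =>
    have hadj : (combinatorialHoroball G).Adj (v, m) (v, m + 1) :=
      combinatorialHoroball_adj_iff.2 (Or.inl ⟨rfl, Or.inl rfl⟩)
    rw [Nat.sub_add_comm hnm, Nat.cast_succ]
    exact SimpleGraph.edist_triangle.trans
      (add_le_add ih (SimpleGraph.edist_eq_one_iff_adj.2 hadj).le)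

theorem edist_combinatorialHoroball_le {v w : V} {n m : ℕ} (hnm : n ≤ m)
    (hvw : G.edist v w ≤ (2 ^ m : ℕ)) :
    (combinatorialHoroball G).edist (v, n) (w, m) ≤ (m - n + 1 : ℕ) := by
  have hhorizontal : (combinatorialHoroball G).edist (v, m) (w, m) ≤ 1 := by
    rw [SimpleGraph.edist_le_one_iff_adj_or_eq, combinatorialHoroball_adj_iff]
    grind
  exact SimpleGraph.edist_triangle.trans
    (add_le_add (edist_combinatorialHoroball_vertical_le v hnm) hhorizontal)

theorem exists_walk_length_le_of_forall_adj {W : Type*} {G' : SimpleGraph W} {f : V → W}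
    (hf : ∀ a b, G.Adj a b → f a = f b ∨ G'.Adj (f a) (f b)) {a b : V} (p : G.Walk a b) :
    ∃ q : G'.Walk (f a) (f b), q.length ≤ p.length ∧ ∀ c ∈ q.support, c ∈ Set.range f := by
  induction p with
  | nil => exact ⟨.nil, le_rfl, by simp⟩
  | @cons a c b hac p ih =>
    obtain ⟨q, hq, hqf⟩ := ih
    rcases hf a c hac with heq | hadj
    · rw [heq]
      exact ⟨q, hq.trans (Nat.le_succ _), hqf⟩
    · exact ⟨.cons hadj q, Nat.succ_le_succ hq, by simpa using hqf⟩

theorem exists_walk_length_le_of_le_height {C : ℕ} {a b : V × ℕ} (ha : C ≤ a.2) (hb : C ≤ b.2)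
    (p : (combinatorialHoroball G).Walk a b) :
    ∃ q : (combinatorialHoroball G).Walk a b, q.length ≤ p.length ∧ ∀ c ∈ q.support, C ≤ c.2 := by
  obtain ⟨q, hq, hqC⟩ :=
    exists_walk_length_le_of_forall_adj (fun _ _ => combinatorialHoroball_adj_max C) p
  refine ⟨q.copy (by rw [max_eq_left ha]) (by rw [max_eq_left hb]), by simpa using hq, ?_⟩
  intro c hc
  obtain ⟨d, rfl⟩ := hqC c (by simpa using hc)
  exact le_max_right _ _

end Horoball

/-! ### The cusped graph -/

section LeftCoset

variable {Γ : Type*} [Group Γ] {H : Subgroup Γ} {S : Set Γ}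

theorem self_mem_leftCosetSet (H : Subgroup Γ) (g : Γ) : g ∈ leftCosetSet H g := by
  simp [leftCosetSet]

theorem mul_mem_leftCosetSet {g h k : Γ} (hh : h ∈ leftCosetSet H g) (hk : k ∈ H) :
    h * k ∈ leftCosetSet H g := by
  simpa only [leftCosetSet, Set.mem_ofPred_eq, mul_assoc] using H.mul_mem hh hk

theorem leftCosetSet_eq_of_mem {g h : Γ} (hh : h ∈ leftCosetSet H g) :
    leftCosetSet H h = leftCosetSet H g := by
  ext k
  have hk : g⁻¹ * k = (g⁻¹ * h) * (h⁻¹ * k) := by group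
  simp only [leftCosetSet, Set.mem_ofPred_eq, hk]
  exact (H.mul_mem_cancel_left hh).symm

theorem reachable_induce_leftCosetSet (hS : Subgroup.closure (S ∩ H) = H) {g : Γ}
    (a b : leftCosetSet H g) :
    ((SimpleGraph.mulCayley S).induce (leftCosetSet H g)).Reachable a b := by
  have hreach : ∀ p ∈ Subgroup.closure (S ∩ H), ∀ a b : leftCosetSet H g, (b : Γ) = a * p →
      ((SimpleGraph.mulCayley S).induce (leftCosetSet H g)).Reachable a b := by
    intro p hp
    induction hp using Subgroup.closure_induction with
    | mem s hs =>
      intro a b hab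
      rcases eq_or_ne a b with rfl | hne
      · rfl
      · refine SimpleGraph.Adj.reachable ((SimpleGraph.mulCayley_adj S _ _).2
          ⟨Subtype.coe_ne_coe.2 hne, Or.inl ?_⟩)
        simpa [hab] using hs.1
    | one =>
      intro a b hab
      rw [Subtype.ext (hab.trans (mul_one _))]
    | mul x y hx _ ihx ihy =>
      intro a b hab
      have hc : (a : Γ) * x ∈ leftCosetSet H g := mul_mem_leftCosetSet a.2 (hS ▸ hx)
      exact (ihx a ⟨_, hc⟩ rfl).trans (ihy ⟨_, hc⟩ b (by rw [hab, mul_assoc]))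
    | inv x _ ih =>
      exact fun a b hab => (ih b a (by rw [hab, inv_mul_cancel_right])).symm
  have hab : (a : Γ)⁻¹ * b ∈ H := by
    have hb : (b : Γ) ∈ leftCosetSet H a := by
      rw [leftCosetSet_eq_of_mem a.2]
      exact b.2
    exact hb
  exact hreach _ (hS.symm ▸ hab) a b (mul_inv_cancel_left _ _).symm

theorem mulCayley_reachable (hS : Subgroup.closure S = ⊤) (g h : Γ) :
    (SimpleGraph.mulCayley S).Reachable g h := by
  have hmem (k : Γ) : k ∈ leftCosetSet ⊤ g := Subgroup.mem_top _
  exact (reachable_induce_leftCosetSet (H := ⊤) (by simpa using hS) ⟨g, hmem g⟩ ⟨h, hmem h⟩).map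
    (SimpleGraph.Embedding.induce _).toHom

end LeftCoset

section Cusped

variable {Γ : Type*} [Group Γ] {I : Type*} {P : I → Subgroup Γ} {S : Set Γ} {i : I} {g : Γ}

/-- The height of a vertex of the cusped graph above the Cayley graph. -/
def CuspedVertex.height {Γ I : Type*} : CuspedVertex Γ I → ℕ
  | base _ => 0
  | deep _ _ n => n + 1

theorem CuspedVertex.height_triple {Γ I : Type*} (g : Γ) (i : I) (n : ℕ) :
    (CuspedVertex.triple g i n).height = n := by
  cases n <;> rfl

theorem CuspedVertex.triple_inj {Γ I : Type*} {g h : Γ} {i : I} {n m : ℕ} :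
    CuspedVertex.triple g i n = CuspedVertex.triple h i m ↔ g = h ∧ n = m := by
  cases n <;> cases m <;> simp [CuspedVertex.triple]

theorem CuspedVertex.index_eq_of_triple_eq {Γ I : Type*} {g h : Γ} {i j : I} {n m : ℕ} (hn : 0 < n)
    (heq : CuspedVertex.triple g i n = CuspedVertex.triple h j m) : i = j := by
  cases n <;> cases m <;> simp_all [CuspedVertex.triple]

theorem CuspedVertex.injective_triple {Γ I : Type*} (A : Set Γ) (i : I) :
    Function.Injective fun a : A × ℕ => CuspedVertex.triple a.1.1 i a.2 :=
  fun _ _ hab =>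
    have hab := CuspedVertex.triple_inj.1 hab
    Prod.ext (Subtype.ext hab.1) hab.2

variable (P S i g) in
/-- The inclusion of the horoball over the coset `g Γ_i` into the cusped graph. -/
def horoballHom :
    combinatorialHoroball ((SimpleGraph.mulCayley S).induce (leftCosetSet (P i) g)) →g
      cuspedGraph P S where
  toFun a := CuspedVertex.triple a.1.1 i a.2
  map_rel' h := Or.inr <| SimpleGraph.iSup_adj.2 ⟨i, SimpleGraph.iSup_adj.2
    ⟨g, SimpleGraph.map_adj_apply' h (CuspedVertex.injective_triple _ i |>.ne h.ne)⟩⟩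

variable (P S) in
/-- The inclusion of the Cayley graph into the cusped graph. -/
def cayleyHom : SimpleGraph.mulCayley S →g cuspedGraph P S where
  toFun := CuspedVertex.base
  map_rel' h := Or.inl (SimpleGraph.map_adj_apply' h fun heq => h.ne (CuspedVertex.base.inj heq))

theorem height_horoballHom (a : leftCosetSet (P i) g × ℕ) :
    (horoballHom P S i g a).height = a.2 :=
  CuspedVertex.height_triple _ _ _

theorem mem_horoballVertices_iff {n : ℕ} {x : CuspedVertex Γ I} :
    x ∈ horoballVertices P i g n ↔ ∃ a, n ≤ a.2 ∧ horoballHom P S i g a = x := by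
  constructor
  · rintro ⟨h, hh, m, hm, rfl⟩
    exact ⟨(⟨h, hh⟩, m), hm, rfl⟩
  · rintro ⟨⟨⟨h, hh⟩, m⟩, hm, rfl⟩
    exact ⟨h, hh, m, hm, rfl⟩

theorem cuspedGraph_adj_iff {x y : CuspedVertex Γ I} :
    (cuspedGraph P S).Adj x y ↔
      (∃ g h, (SimpleGraph.mulCayley S).Adj g h ∧ cayleyHom P S g = x ∧ cayleyHom P S h = y) ∨
      ∃ i g a b, (combinatorialHoroball
        ((SimpleGraph.mulCayley S).induce (leftCosetSet (P i) g))).Adj a b ∧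
          horoballHom P S i g a = x ∧ horoballHom P S i g b = y := by
  constructor
  · simp only [cuspedGraph, SimpleGraph.sup_adj, SimpleGraph.iSup_adj, SimpleGraph.map_adj']
    rintro (⟨-, h⟩ | ⟨i, g, -, h⟩)
    · exact Or.inl h
    · exact Or.inr ⟨i, g, h⟩
  · rintro (⟨g, h, hgh, rfl, rfl⟩ | ⟨i, g, a, b, hab, rfl, rfl⟩)
    · exact (cayleyHom P S).map_adj hgh
    · exact (horoballHom P S i g).map_adj hab

theorem cuspedGraph_connected (hS : Subgroup.closure S = ⊤) : (cuspedGraph P S).Connected := by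
  have : Nonempty (CuspedVertex Γ I) := ⟨.base 1⟩
  have hbase (x : CuspedVertex Γ I) : (cuspedGraph P S).Reachable (.base 1) x := by
    rcases x with g | ⟨g, i, n⟩
    · exact (mulCayley_reachable hS 1 g).map (cayleyHom P S)
    · have hcolumn := SimpleGraph.edist_ne_top_iff_reachable.1 <| ne_top_of_le_ne_top
        (ENat.natCast_ne_top _) <| edist_combinatorialHoroball_vertical_le
          (G := (SimpleGraph.mulCayley S).induce (leftCosetSet (P i) g))
          ⟨g, self_mem_leftCosetSet (P i) g⟩ (Nat.zero_le (n + 1))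
      exact ((mulCayley_reachable hS 1 g).map (cayleyHom P S)).trans
        (hcolumn.map (horoballHom P S i g))
  exact ⟨fun x y => (hbase x).symm.trans (hbase y)⟩

theorem exists_adj_of_adj_horoballHom {a : leftCosetSet (P i) g × ℕ} {y : CuspedVertex Γ I}
    (ha : 0 < a.2) (hy : (cuspedGraph P S).Adj (horoballHom P S i g a) y) :
    ∃ b, (combinatorialHoroball
      ((SimpleGraph.mulCayley S).induce (leftCosetSet (P i) g))).Adj a b ∧
        horoballHom P S i g b = y := by
  obtain ⟨k, l, -, heq, -⟩ | ⟨j, k, c, d, hcd, heq, rfl⟩ := cuspedGraph_adj_iff.1 hy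
  · have hheight := congrArg CuspedVertex.height heq
    rw [height_horoballHom] at hheight
    exact absurd hheight ha.ne
  · obtain rfl := CuspedVertex.index_eq_of_triple_eq ha heq.symm
    obtain ⟨hv, hn⟩ := CuspedVertex.triple_inj.1 heq
    have hcoset : leftCosetSet (P i) k = leftCosetSet (P i) g :=
      (leftCosetSet_eq_of_mem (hv ▸ c.1.2)).symm.trans (leftCosetSet_eq_of_mem a.1.2)
    change ∃ b : leftCosetSet (P i) g × ℕ,
      _ ∧ CuspedVertex.triple b.1.1 i b.2 = CuspedVertex.triple d.1.1 i d.2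
    clear heq hy
    generalize leftCosetSet (P i) k = A at *
    subst hcoset
    obtain rfl : c = a := Prod.ext (Subtype.ext hv) hn
    exact ⟨d, hcd, rfl⟩

theorem exists_horoball_walk {x y : CuspedVertex Γ I} (p : (cuspedGraph P S).Walk x y)
    (hp : ∀ c ∈ p.support, 0 < c.height) {a : leftCosetSet (P i) g × ℕ}
    (ha : horoballHom P S i g a = x) :
    ∃ b, horoballHom P S i g b = y ∧ ∃ q : (combinatorialHoroball
      ((SimpleGraph.mulCayley S).induce (leftCosetSet (P i) g))).Walk a b,
        q.length = p.length := by
  induction p generalizing a with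
  | nil => exact ⟨a, ha, .nil, rfl⟩
  | cons hadj p ih =>
    subst ha
    have hpos : 0 < a.2 := by
      simpa only [height_horoballHom] using hp _ (SimpleGraph.Walk.start_mem_support _)
    obtain ⟨c, hac, hc⟩ := exists_adj_of_adj_horoballHom hpos hadj
    obtain ⟨b, hb, q, hq⟩ := ih (fun d hd => hp d (List.mem_cons_of_mem _ hd)) hc
    exact ⟨b, hb, .cons hac q, by simp only [SimpleGraph.Walk.length_cons, hq]⟩

theorem height_le_height_add_one_of_adj {x y : CuspedVertex Γ I} (h : (cuspedGraph P S).Adj x y) :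
    y.height ≤ x.height + 1 := by
  obtain ⟨k, l, -, -, rfl⟩ | ⟨i, g, a, b, hab, rfl, rfl⟩ := cuspedGraph_adj_iff.1 h
  · exact Nat.zero_le _
  · rw [combinatorialHoroball_adj_iff] at hab
    rw [height_horoballHom, height_horoballHom]
    lia

theorem height_le_height_add_dist (hX : (cuspedGraph P S).Connected) (x y : CuspedVertex Γ I) :
    y.height ≤ x.height + (cuspedGraph P S).dist x y := by
  obtain ⟨p, hp⟩ := hX.exists_walk_length_eq_dist x y
  rw [← hp]
  clear hp
  induction p with
  | nil => simp
  | cons h p ih =>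
    have := height_le_height_add_one_of_adj h
    rw [SimpleGraph.Walk.length_cons]
    lia

theorem height_le_of_mem_geodesic (hX : (cuspedGraph P S).Connected) {x y c : CuspedVertex Γ I}
    {p : (cuspedGraph P S).Walk x y} (hp : p.length = (cuspedGraph P S).dist x y)
    (hxy : (cuspedGraph P S).dist x y + x.height ≤ y.height + 1) (hc : c ∈ p.support) :
    x.height ≤ c.height := by
  rcases eq_or_ne x c with rfl | hne
  · exact le_rfl
  · have hpos := hX.pos_dist_of_ne hne
    have hsplit := dist_add_dist_of_mem_support hp hc
    have hrise := height_le_height_add_dist hX c y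
    lia

theorem dist_horoballHom_add_le {a b : leftCosetSet (P i) g × ℕ} (hab : a.2 ≤ b.2)
    (hdist : ((SimpleGraph.mulCayley S).induce (leftCosetSet (P i) g)).edist a.1 b.1 ≤
      (2 ^ b.2 : ℕ)) :
    (cuspedGraph P S).dist (horoballHom P S i g a) (horoballHom P S i g b) + a.2 ≤ b.2 + 1 := by
  obtain ⟨p, hp⟩ := exists_walk_length_le_of_edist_le (edist_combinatorialHoroball_le hab hdist)
  have := SimpleGraph.dist_le (p.map (horoballHom P S i g))
  rw [SimpleGraph.Walk.length_map] at this
  lia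

theorem exists_dist_horoballHom_add_le (hP : Subgroup.closure (S ∩ P i) = P i)
    (a b : leftCosetSet (P i) g × ℕ) : ∃ z,
      (cuspedGraph P S).dist (horoballHom P S i g a) (horoballHom P S i g z) + a.2 ≤ z.2 + 1 ∧
      (cuspedGraph P S).dist (horoballHom P S i g b) (horoballHom P S i g z) + b.2 ≤ z.2 + 1 := by
  obtain ⟨p⟩ := reachable_induce_leftCosetSet hP b.1 a.1
  let N := max (max a.2 b.2) p.length
  have hN : p.length ≤ 2 ^ N := (le_max_right _ _).trans Nat.lt_two_pow_self.le
  exact ⟨(a.1, N), dist_horoballHom_add_le (by simp [N]) (by simp),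
    dist_horoballHom_add_le (by simp [N]) (p.edist_le.trans (Nat.cast_le.2 hN))⟩

theorem height_pos_of_mem_geodesic {δ C : ℕ} (hX : (cuspedGraph P S).Connected)
    (hP : Subgroup.closure (S ∩ P i) = P i) (hδ : IsHyperbolicGraph (cuspedGraph P S) δ)
    (hC : δ < C) {a b : leftCosetSet (P i) g × ℕ} (ha : C ≤ a.2) (hb : C ≤ b.2)
    {p : (cuspedGraph P S).Walk (horoballHom P S i g a) (horoballHom P S i g b)}
    (hp : p.length = (cuspedGraph P S).dist (horoballHom P S i g a) (horoballHom P S i g b))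
    {c : CuspedVertex Γ I} (hc : c ∈ p.support) : 0 < c.height := by
  obtain ⟨z, haz, hbz⟩ := exists_dist_horoballHom_add_le hP a b
  simp only [← height_horoballHom (S := S)] at ha hb haz hbz
  obtain ⟨q, hq⟩ := hX.exists_walk_length_eq_dist (horoballHom P S i g b) (horoballHom P S i g z)
  obtain ⟨r, hr⟩ := hX.exists_walk_length_eq_dist (horoballHom P S i g a) (horoballHom P S i g z)
  obtain ⟨w, hw, hcw⟩ := hδ _ _ _ p q r hp hq hr c hc
  rw [edist_le_natCast_iff hX] at hcw
  have hwC : C ≤ w.height := hw.elim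
    (fun hw => hb.trans (height_le_of_mem_geodesic hX hq hbz hw))
    (fun hw => ha.trans (height_le_of_mem_geodesic hX hr haz hw))
  have := height_le_height_add_dist hX c w
  lia

theorem isGeodesicallyStarShaped_horoballVertices {δ C : ℕ} (hX : (cuspedGraph P S).Connected)
    (hP : Subgroup.closure (S ∩ P i) = P i) (hδ : IsHyperbolicGraph (cuspedGraph P S) δ)
    (hC : δ < C) {o : CuspedVertex Γ I} (ho : o ∈ horoballVertices P i g C) :
    IsGeodesicallyStarShaped (cuspedGraph P S) (horoballVertices P i g C) o := by
  intro v hv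
  obtain ⟨a, ha, rfl⟩ := mem_horoballVertices_iff (S := S).1 ho
  obtain ⟨b, hb, rfl⟩ := mem_horoballVertices_iff (S := S).1 hv
  obtain ⟨p, hp⟩ := hX.exists_walk_length_eq_dist (horoballHom P S i g a) (horoballHom P S i g b)
  obtain ⟨b', hb', q, hq⟩ := exists_horoball_walk p
    (fun c hc => height_pos_of_mem_geodesic hX hP hδ hC ha hb hp hc) rfl
  obtain rfl := CuspedVertex.injective_triple _ i hb'
  obtain ⟨r, hr, hrC⟩ := exists_walk_length_le_of_le_height ha hb q
  refine ⟨r.map (horoballHom P S i g), le_antisymm ?_ (SimpleGraph.dist_le _), fun c hc => ?_⟩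
  · rw [SimpleGraph.Walk.length_map, ← hp, ← hq]
    exact hr
  · rw [SimpleGraph.Walk.support_map, List.mem_map] at hc
    obtain ⟨d, hd, rfl⟩ := hc
    exact mem_horoballVertices_iff.2 ⟨d, hrC d hd, rfl⟩

end Cusped

theorem mainTheorem5_general {Γ : Type*} [Group Γ] {I : Type*} (P : I → Subgroup Γ) (S : Set Γ)
    (hS : Subgroup.closure S = ⊤) (hP : ∀ i, Subgroup.closure (S ∩ P i) = P i) (δ : ℕ)
    (hδ : IsHyperbolicGraph (cuspedGraph P S) δ) (C : ℕ) (hC : δ < C) (κ : ℕ) (hκ : 4 * δ ≤ κ)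
    (hκ₀ : κ ≠ 0) :
    ContractibleSpace (SCRealization (ripsComplex (cuspedGraph P S) κ)) ∧
    (∀ (i : I) (g : Γ), ContractibleSpace
      (SCRealization (fullSubcomplex (ripsComplex (cuspedGraph P S) κ)
        (horoballVertices P i g C)))) ∧
    (∀ (v : CuspedVertex Γ I) (r : ℕ), ContractibleSpace
      (SCRealization (complexBall (ripsComplex (cuspedGraph P S) κ) v r))) := by
  have hX : (cuspedGraph P S).Connected := cuspedGraph_connected hS
  refine ⟨contractibleSpace_ripsComplex hδ hX hκ hκ₀, fun i g => ?_,
    contractibleSpace_complexBall_ripsComplex hδ hX hκ hκ₀⟩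
  have ho : CuspedVertex.triple g i C ∈ horoballVertices P i g C :=
    ⟨g, self_mem_leftCosetSet (P i) g, C, le_rfl, rfl⟩
  exact (isGeodesicallyStarShaped_horoballVertices hX (hP i) hδ hC ho).contractibleSpace_ripsComplex
    hδ hX hκ hκ₀ ho

theorem mainTheorem5 {Γ : Type u} [Group Γ] {I : Type v} [Finite I] [Nonempty I]
    (P : I → Subgroup Γ) (S : Set Γ) (hS : IsCompatibleGeneratingSet P S)
    (δ : ℕ) (hδ : IsHyperbolicGraph (cuspedGraph P S) δ)
    (C : ℕ) (hC : δ < C) (κ : ℕ) (hκ : 4 * δ + 6 ≤ κ) :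
    ContractibleSpace (SCRealization (ripsComplex (cuspedGraph P S) κ)) ∧
    (∀ (i : I) (g : Γ), ContractibleSpace
      (SCRealization (fullSubcomplex (ripsComplex (cuspedGraph P S) κ)
        (horoballVertices P i g C)))) ∧
    (∀ (v : CuspedVertex Γ I) (r : ℕ), ContractibleSpace
      (SCRealization (complexBall (ripsComplex (cuspedGraph P S) κ) v r))) :=
  mainTheorem5_general P S hS.closure_eq_top hS.closure_inter δ hδ C hC κ (by lia) (by lia)
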